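/- **Proposition 7.** Let $1\le k<n$, $\mu\in\mathbb R\setminus\{0\}$, $\lambda>0$, $c>0$. Let $C^n_k$ be the set of all $k$-element subsets of $\{1,\dots,n\}$, put $N=\binom nk=|C^n_k|$, and let $p_i\ge 0$ $(i\in C^n_k)$ with $\sum_{i} p_i=1$. Let $B=(B^1,\dots,B^n)$ be a standard $n$-dimensional Brownian motion (with continuous paths, $B_0=0$) on a probability space $(\Omega,\mathcal F,\mathsf P)$. For $\varphi=(\varphi_i)_{i\in C^n_k}\in[0,\infty)^N$ let $\varPhi=(\varPhi^i)_{i\in C^n_k}$ be the process started at $\varphi$ given by $$\varPhi^i_t=e^{\lambda t}L^i_t\Big(\varphi_i+\lambda\int_0^t\frac{ds}{e^{\lambda s}L^i_s}\Big),\qquad L^i_t=\exp\Big(\mu\sum_{j\in i}B^j_t-k\,\frac{\mu^2}{2}\,t\Big)\qquad(t\ge0),$$ and write $\mathsf P_\varphi$, $\mathsf E_\varphi$ for probability and expectation when $\varPhi_0=\varphi$. Define $$\hat V(\varphi)=\inf_\tau \mathsf E_\varphi\Big[\int_0^\tau e^{-\lambda t}\Big(\sum_{i}p_i\varPhi^i_t-\frac{\lambda}{c}\Big)dt\Big],$$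 where the infimum is over all stopping times $\tau$ (with values in $[0,\infty]$) of the natural filtration of $\varPhi$, the expectation being allowed to equal $+\infty$. Let $C=\{\varphi\in[0,\infty)^N:\hat V(\varphi)<0\}$ be the continuation set, $D=\{\varphi\in[0,\infty)^N:\hat V(\varphi)=0\}$ the stopping set, and let $\partial C$ be the topological boundary of $C$ in $[0,\infty)^N$. Then $\partial C$ is probabilistically regular for $D$: for every $\varphi\in\partial C$, $$\mathsf P_\varphi(\sigma_D=0)=1,\qquad\text{where }\ \sigma_D=\inf\{t>0:\varPhi_t\in D\}.$$ -/

import Mathlib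

open MeasureTheory ProbabilityTheory
open scoped NNReal ENNReal

noncomputable section

namespace QuickestDetection

/-- A standard `n`-dimensional Brownian motion: independent coordinate processes, each of which is
a standard real Brownian motion, realised with every path continuous and started at the origin. -/
structure IsStandardBrownian {Ω : Type*} [MeasurableSpace Ω] {n : ℕ}
    (B : Fin n → ℝ≥0 → Ω → ℝ) (P : Measure Ω) : Prop where
  brownian : ∀ j, IsBrownianReal (B j) P
  indep : iIndepFun (fun j ω t => B j t ω) P
  measurable : ∀ j t, Measurable (B j t)
  continuous : ∀ j ω, Continuous fun t => B j t ω
  zero : ∀ j ω, B j 0 ω = 0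

/-- The `N = n.choose k` subsets of `{1, …, n}` with exactly `k` elements. -/
abbrev Idx (n k : ℕ) : Type := {S : Finset (Fin n) // S.card = k}

/-- The state space `[0,∞)^N`, with its product topology. -/
abbrev State (n k : ℕ) : Type := Idx n k → ℝ≥0

section Flow

variable {Ω : Type*} {n k : ℕ}

/-- The likelihood ratio `L^i_t = exp (μ ∑_{j ∈ i} B^j_t - k (μ² / 2) t)`. -/
def likelihood (mu : ℝ) (B : Fin n → ℝ≥0 → Ω → ℝ) (i : Idx n k) (t : ℝ≥0) (ω : Ω) : ℝ :=
  Real.exp (mu * ∑ j ∈ i.1, B j t ω - k * (mu ^ 2 / 2) * t)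

/-- `e^{λ t} L^i_t (φ_i + λ ∫₀ᵗ ds / (e^{λ s} L^i_s))` as a real number. -/
def ratioReal (mu lam : ℝ) (B : Fin n → ℝ≥0 → Ω → ℝ) (φ : State n k) (i : Idx n k)
    (t : ℝ≥0) (ω : Ω) : ℝ :=
  Real.exp (lam * t) * likelihood mu B i t ω *
    (φ i + lam * ∫ s in (0 : ℝ)..t, 1 / (Real.exp (lam * s) * likelihood mu B i s.toNNReal ω))

/-- The posterior ratio process `Φ` started at `φ`, with values in `[0,∞)^N`. -/
def ratio (mu lam : ℝ) (B : Fin n → ℝ≥0 → Ω → ℝ) (φ : State n k) (t : ℝ≥0) (ω : Ω) :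
    State n k :=
  fun i => (ratioReal mu lam B φ i t ω).toNNReal

/-- The truncation in `ratio` is never active. -/
lemma coe_ratio (mu lam : ℝ) (hlam : 0 ≤ lam) (B : Fin n → ℝ≥0 → Ω → ℝ) (φ : State n k)
    (t : ℝ≥0) (ω : Ω) (i : Idx n k) :
    (ratio mu lam B φ t ω i : ℝ) = ratioReal mu lam B φ i t ω := by
  refine Real.coe_toNNReal _ (mul_nonneg ?_ (add_nonneg (φ i).2 (mul_nonneg hlam ?_)))
  · unfold likelihood; positivity
  · refine intervalIntegral.integral_nonneg t.2 fun s _ => ?_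
    unfold likelihood; positivity

/-- `τ` is a stopping time of the process `Y`, that is, with respect to the natural filtration
`σ(Y_s | 0 ≤ s ≤ t)` of `Y`; the value `∞` is allowed. -/
def IsStoppingTimeOf {E : Type*} [MeasurableSpace E] (Y : ℝ≥0 → Ω → E) (τ : Ω → ℝ≥0∞) : Prop :=
  ∀ t : ℝ≥0, MeasurableSet[⨆ s ≤ t, MeasurableSpace.comap (Y s) inferInstance] {ω | τ ω ≤ t}

/-- For a measurable process this is Mathlib's notion for Mathlib's natural filtration. -/
lemma isStoppingTimeOf_iff [MeasurableSpace Ω] (Y : ℝ≥0 → Ω → State n k)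
    (hY : ∀ t, StronglyMeasurable (Y t)) (τ : Ω → ℝ≥0∞) :
    IsStoppingTimeOf Y τ ↔ IsStoppingTime (Filtration.natural Y hY) τ :=
  Iff.rfl

/-- The first hitting time `σ_A = inf {t > 0 | Y_t ∈ A}` (with `inf ∅ = ∞`). -/
def hittingTime {E : Type*} (Y : ℝ≥0 → Ω → E) (A : Set E) (ω : Ω) : ℝ≥0∞ :=
  ⨅ (t : ℝ≥0) (_ : 0 < t ∧ Y t ω ∈ A), (t : ℝ≥0∞)

variable [MeasurableSpace Ω]

/-- `E_φ [∫₀^τ e^{-λ t} (∑_i p_i Φ^i_t - λ / c) dt]`, as an extended real number. The integrand is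
the difference of two nonnegative terms; the second has finite integral (at most `1 / c`), and the
first may have integral `+∞`. -/
def expectedCost (mu lam c : ℝ) (p : Idx n k → ℝ) (B : Fin n → ℝ≥0 → Ω → ℝ) (P : Measure Ω)
    (φ : State n k) (τ : Ω → ℝ≥0∞) : EReal :=
  ((∫⁻ ω, (∫⁻ t in {t : ℝ | 0 < t ∧ ENNReal.ofReal t < τ ω},
      ENNReal.ofReal (Real.exp (-lam * t) *
        ∑ i, p i * (ratio mu lam B φ t.toNNReal ω i : ℝ))) ∂P : ℝ≥0∞) : EReal) -
  ((∫⁻ ω, (∫⁻ t in {t : ℝ | 0 < t ∧ ENNReal.ofReal t < τ ω},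
      ENNReal.ofReal (Real.exp (-lam * t) * (lam / c))) ∂P : ℝ≥0∞) : EReal)

/-- The value function: the infimum of the expected cost over all stopping times of `Φ`. -/
def value (mu lam c : ℝ) (p : Idx n k → ℝ) (B : Fin n → ℝ≥0 → Ω → ℝ) (P : Measure Ω)
    (φ : State n k) : EReal :=
  ⨅ (τ : Ω → ℝ≥0∞) (_ : IsStoppingTimeOf (ratio mu lam B φ) τ),
    expectedCost mu lam c p B P φ τ

/-- The continuation set `C`. -/
def continuationSet (mu lam c : ℝ) (p : Idx n k → ℝ) (B : Fin n → ℝ≥0 → Ω → ℝ)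
    (P : Measure Ω) : Set (State n k) :=
  {φ | value mu lam c p B P φ < 0}

/-- The stopping set `D`. -/
def stoppingSet (mu lam c : ℝ) (p : Idx n k → ℝ) (B : Fin n → ℝ≥0 → Ω → ℝ)
    (P : Measure Ω) : Set (State n k) :=
  {φ | value mu lam c p B P φ = 0}

/-- `φ` is probabilistically regular for `A`: started at `φ`, the process `Φ` satisfies
`σ_A = 0` with probability one. -/
def IsRegularFor (mu lam : ℝ) (B : Fin n → ℝ≥0 → Ω → ℝ) (P : Measure Ω)
    (A : Set (State n k)) (φ : State n k) : Prop :=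
  ∀ᵐ ω ∂P, hittingTime (ratio mu lam B φ) A ω = 0

end Flow

end QuickestDetection

end

namespace QuickestDetection

open Filter Topology

/-! Regularity holds at every point of D, by monotonicity rather than by any fine description of the
boundary. Each Φ^i is nondecreasing in its starting value, so the value function is nondecreasing
and, being at most 0, makes D an upper set (`mem_stoppingSet_of_le`). Whenever μ B^j_t ≥ μ² t / 2
for all j at once, every L^i_t is at least 1 and Φ_t ≥ φ. Such times almost surely accumulate at 0
(`ae_exists_lt_forall_sq_le`): time inversion moves the question to infinity, where the
Borel–Cantelli lemmas apply along a fast growing sequence of times. Hence Φ started in D is in D at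
arbitrarily small positive times.

That ∂C ⊆ D follows from openness of C (`isOpen_continuationSet`). A stopping time with negative
cost at φ still has negative cost after truncation at a large T, and the truncated delay cost moves
little with φ, because E ∫₀ᵀ ∑ p_i L^i_t dt is finite.

Both arguments use one stopping time for two starting points, while the natural filtration formally
depends on the start. `IsStoppingTimeOf.of_ratio` settles this: writing Φ^i = y A with y = e^{λt}
L^i, one has (log A)' = λ / Φ^i, so the path of Φ^i up to t determines y up to t. -/

/-! ### Joint excursions of independent Brownian motions -/

/-- A centred Gaussian variable exceeds its standard deviation with the probability that a standard
one exceeds `1`. -/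
lemma measure_sqrt_le_of_hasLaw_gaussianReal {Ω : Type*} [MeasurableSpace Ω] {P : Measure Ω}
    {X : Ω → ℝ} {v : ℝ≥0} (hv : v ≠ 0) (hX : HasLaw X (gaussianReal 0 v) P) :
    P (X ⁻¹' Set.Ici √v) = gaussianReal 0 1 (Set.Ici 1) := by
  have hv0 : (0 : ℝ) < v := NNReal.coe_pos.2 (pos_iff_ne_zero.2 hv)
  have hs : 0 < √(v : ℝ) := Real.sqrt_pos.2 hv0
  have hZ := gaussianReal_const_mul hX (√(v : ℝ))⁻¹
  have h1 : NNReal.mk ((√(v : ℝ))⁻¹ ^ 2) (sq_nonneg _) * v = 1 := by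
    ext
    push_cast
    rw [inv_pow, Real.sq_sqrt hv0.le]
    field_simp
  rw [h1, mul_zero] at hZ
  rw [← hZ.map_eq, Measure.map_apply_of_aemeasurable hZ.aemeasurable measurableSet_Ici]
  congr 1
  ext ω
  simp only [Set.mem_preimage, Set.mem_Ici]
  rw [inv_mul_eq_div, le_div_iff₀ hs, one_mul]

lemma gaussianReal_Ici_ne_zero (a : ℝ) : gaussianReal 0 1 (Set.Ici a) ≠ 0 := by
  intro h
  have := gaussianReal_absolutelyContinuous' 0 one_ne_zero h
  simp at this

/-- Chebyshev's inequality for a centred Gaussian variable. -/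
lemma measure_le_abs_of_hasLaw_gaussianReal {Ω : Type*} [MeasurableSpace Ω] {P : Measure Ω}
    [IsProbabilityMeasure P] {X : Ω → ℝ} {v : ℝ≥0} (hX : HasLaw X (gaussianReal 0 v) P)
    {a : ℝ} (ha : 0 < a) : P {ω | a ≤ |X ω|} ≤ ENNReal.ofReal (v / a ^ 2) := by
  have h := meas_ge_le_variance_div_sq hX.hasGaussianLaw.memLp_two ha
  rw [hX.integral_eq, hX.variance_eq, integral_id_gaussianReal, variance_id_gaussianReal] at h
  simpa using h

/-- The squared factorials, a sequence of times along which increments dominate the past. -/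
def sparseTime (m : ℕ) : ℝ≥0 := ((m + 1).factorial : ℝ≥0) ^ 2

lemma sparseTime_pos (m : ℕ) : 0 < sparseTime m := by
  unfold sparseTime; positivity

/-- Consecutive times have ratio (m + 2)², and (m + 2)² - 1 = (m + 1)(m + 3). -/
lemma sparseTime_succ (m : ℕ) :
    sparseTime (m + 1) = sparseTime m + sparseTime m * ((m + 1) * (m + 3)) := by
  unfold sparseTime
  rw [Nat.factorial_succ (m + 1)]
  push_cast
  ring

lemma monotone_sparseTime : Monotone sparseTime :=
  monotone_nat_of_le_succ fun m => by rw [sparseTime_succ]; exact le_self_add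

lemma le_sparseTime (m : ℕ) : (m : ℝ≥0) ≤ sparseTime m := by
  have h : m + 1 ≤ (m + 1).factorial := Nat.self_le_factorial _
  have h' : (m : ℝ≥0) + 1 ≤ ((m + 1).factorial : ℝ≥0) := by exact_mod_cast h
  unfold sparseTime
  calc (m : ℝ≥0) ≤ m + 1 := le_self_add
    _ ≤ (m + 1) ^ 2 := le_self_pow₀ le_add_self two_ne_zero
    _ ≤ _ := by gcongr

/-- The length of the `m`-th interval between sparse times. -/
def sparseGap (m : ℕ) : ℝ≥0 := sparseTime m * ((m + 1) * (m + 3))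

lemma sparseGap_pos (m : ℕ) : 0 < sparseGap m :=
  mul_pos (sparseTime_pos m) (by positivity)

lemma nndist_sparseTime (m : ℕ) :
    nndist (sparseTime (m + 1)).1 (sparseTime m).1 = sparseGap m := by
  ext
  rw [coe_nndist, Real.dist_eq]
  change |((sparseTime (m + 1) : ℝ≥0) : ℝ) - (sparseTime m : ℝ≥0)| = _
  rw [sparseTime_succ, NNReal.coe_add, add_sub_cancel_left, abs_of_nonneg (NNReal.coe_nonneg _)]
  rfl

lemma le_sparseGap (m : ℕ) : (m : ℝ≥0) ≤ sparseGap m := by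
  refine (le_sparseTime m).trans (le_mul_of_one_le_right (zero_le) ?_)
  have h1 : (1 : ℝ≥0) ≤ m + 1 := le_add_self
  have h3 : (1 : ℝ≥0) ≤ m + 3 := le_trans (by norm_num) (le_add_self (a := (3 : ℝ≥0)))
  exact one_le_mul h1 h3

section Excursion

variable {Ω ι : Type*} [MeasurableSpace Ω] {P : Measure Ω} {W : ι → ℝ≥0 → Ω → ℝ}

/-- The event that every coordinate makes a large increment over the `m`-th gap. -/
def largeIncrement (W : ι → ℝ≥0 → Ω → ℝ) (m : ℕ) : Set Ω :=
  ⋂ j, (fun ω => W j (sparseTime (m + 1)) ω - W j (sparseTime m) ω) ⁻¹' Set.Ici √(sparseGap m)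

lemma iIndepFun_increments (hW : ∀ j, IsPreBrownianReal (W j) P)
    (hind : iIndepFun (fun j ω t => W j t ω) P) (hm : ∀ j t, Measurable (W j t)) :
    iIndepFun (fun (q : ι × ℕ) ω =>
      W q.1 (sparseTime (q.2 + 1)) ω - W q.1 (sparseTime q.2) ω) P := by
  refine iIndepFun_uncurry'
    (X := fun j m ω => W j (sparseTime (m + 1)) ω - W j (sparseTime m) ω)
    (fun j m => (hm j _).sub (hm j _)) ?_
    fun j => (hW j).hasIndepIncrements.nat monotone_sparseTime
  exact hind.comp (fun _ (x : ℝ≥0 → ℝ) (m : ℕ) => x (sparseTime (m + 1)) - x (sparseTime m))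
    fun _ => by fun_prop

/-- Singletons give the probability of each event and general `s` then gives independence in `m`.
Scaling by the standard deviation makes the probability the same for all `m`, so the second
Borel–Cantelli lemma applies. -/
lemma measure_biInter_largeIncrement [Fintype ι] (hW : ∀ j, IsPreBrownianReal (W j) P)
    (hind : iIndepFun (fun j ω t => W j t ω) P) (hm : ∀ j t, Measurable (W j t))
    (s : Finset ℕ) :
    P (⋂ m ∈ s, largeIncrement W m) =
      ∏ _m ∈ s, gaussianReal 0 1 (Set.Ici 1) ^ Fintype.card ι := by
  have h := (iIndepFun_increments hW hind hm).measure_inter_preimage_eq_mul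
    (Finset.univ ×ˢ s) (sets := fun q => Set.Ici √(sparseGap q.2)) fun _ _ => measurableSet_Ici
  have hset : (⋂ m ∈ s, largeIncrement W m) = ⋂ q ∈ (Finset.univ : Finset ι) ×ˢ s,
      (fun ω => W q.1 (sparseTime (q.2 + 1)) ω - W q.1 (sparseTime q.2) ω) ⁻¹'
        Set.Ici √(sparseGap q.2) := by
    ext ω
    simp only [largeIncrement, Set.mem_iInter, Finset.mem_product, Finset.mem_univ, true_and,
      Prod.forall]
    exact ⟨fun h j m hm => h m hm j, fun h m hm j => h j m hm⟩
  rw [hset, h, Finset.prod_product_right]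
  refine Finset.prod_congr rfl fun m _ => ?_
  rw [Finset.prod_congr rfl fun j _ => measure_sqrt_le_of_hasLaw_gaussianReal
    (sparseGap_pos m).ne' (by
      have := (hW j).hasLaw_sub (sparseTime (m + 1)) (sparseTime m)
      rwa [nndist_sparseTime] at this)]
  simp

lemma ae_frequently_largeIncrement [Fintype ι] (hW : ∀ j, IsPreBrownianReal (W j) P)
    (hind : iIndepFun (fun j ω t => W j t ω) P) (hm : ∀ j t, Measurable (W j t)) :
    ∀ᵐ ω ∂P, ∃ᶠ m in atTop, ω ∈ largeIncrement W m := by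
  have := hind.isProbabilityMeasure
  have hmeas : ∀ m, MeasurableSet (largeIncrement W m) := fun m =>
    MeasurableSet.iInter fun j => ((hm j _).sub (hm j _)) measurableSet_Ici
  have h1 : ∀ m, P (largeIncrement W m) = gaussianReal 0 1 (Set.Ici 1) ^ Fintype.card ι := by
    intro m
    simpa using measure_biInter_largeIncrement hW hind hm {m}
  have hindep : iIndepSet (largeIncrement W) P := by
    rw [iIndepSet_iff_meas_biInter hmeas]
    intro s
    simp_rw [h1]
    exact measure_biInter_largeIncrement hW hind hm s
  have hone := measure_limsup_eq_one hmeas hindep (by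
    simp_rw [h1]
    exact ENNReal.tsum_const_eq_top_of_ne_zero (pow_ne_zero _ (gaussianReal_Ici_ne_zero 1)))
  have hmem := (mem_ae_iff_prob_eq_one (MeasurableSet.measurableSet_limsup hmeas)).2 hone
  filter_upwards [hmem] with ω hω
  exact mem_limsup_iff_frequently_mem.1 hω

/-- At sparse times a Brownian motion is eventually small compared with the following gap. -/
lemma ae_eventually_abs_lt {X : ℝ≥0 → Ω → ℝ} [IsProbabilityMeasure P]
    (hX : IsPreBrownianReal X P) :
    ∀ᵐ ω ∂P, ∀ᶠ m in atTop, |X (sparseTime m) ω| < √(sparseGap m) / 2 := by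
  have hsum : ∑' m, P {ω | √(sparseGap m) / 2 ≤ |X (sparseTime m) ω|} ≠ ∞ := by
    -- Chebyshev gives 4 / ((m + 1)(m + 3)), which is at most 4 / (m + 1)².
    have hs : Summable fun m : ℕ => 4 * (1 / ((m : ℝ) + 1) ^ 2) := by
      refine Summable.mul_left _ ?_
      exact_mod_cast (summable_nat_add_iff 1).2 (Real.summable_one_div_nat_pow.2 one_lt_two)
    refine ne_top_of_le_ne_top hs.tsum_ofReal_ne_top (ENNReal.tsum_le_tsum fun m => ?_)
    have hg : (0 : ℝ) < sparseGap m := sparseGap_pos m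
    refine (measure_le_abs_of_hasLaw_gaussianReal (hX.hasLaw_eval (sparseTime m))
      (half_pos (Real.sqrt_pos.2 hg))).trans (ENNReal.ofReal_le_ofReal ?_)
    have ht : (0 : ℝ) < sparseTime m := sparseTime_pos m
    have hgap : (sparseGap m : ℝ) = sparseTime m * ((m + 1) * (m + 3)) := by
      simp [sparseGap]
    rw [div_pow, Real.sq_sqrt hg.le, hgap]
    rw [div_le_iff₀ (by positivity)]
    field_simp
    nlinarith
  filter_upwards [ae_eventually_notMem hsum] with ω hω
  filter_upwards [hω] with m hm
  simpa using hm

/-- Independent Brownian motions simultaneously exceed any level at arbitrarily large times. -/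
lemma ae_frequently_forall_le [Fintype ι] (hW : ∀ j, IsPreBrownianReal (W j) P)
    (hind : iIndepFun (fun j ω t => W j t ω) P) (hm : ∀ j t, Measurable (W j t)) (a : ℝ) :
    ∀ᵐ ω ∂P, ∃ᶠ t in atTop, ∀ j, a ≤ W j t ω := by
  have := hind.isProbabilityMeasure
  have hgap : Tendsto (fun m => √(sparseGap m : ℝ) / 2) atTop atTop := by
    refine (Real.tendsto_sqrt_atTop.comp ?_).atTop_div_const two_pos
    exact tendsto_atTop_mono (fun m => by exact_mod_cast le_sparseGap m)
      tendsto_natCast_atTop_atTop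
  have htime : Tendsto (fun m => sparseTime (m + 1)) atTop atTop :=
    (tendsto_atTop_mono le_sparseTime tendsto_natCast_atTop_atTop).comp (tendsto_add_atTop_nat 1)
  filter_upwards [ae_frequently_largeIncrement hW hind hm,
    -- An increment of at least √gap starting above -√gap / 2 ends above √gap / 2, which eventually
    -- exceeds `a`.
    ae_all_iff.2 fun j => ae_eventually_abs_lt (hW j)] with ω hfreq hev
  refine htime.frequently ?_
  refine (hfreq.and_eventually ((eventually_all.2 hev).and
    (hgap.eventually_ge_atTop a))).mono fun m ⟨hm, hsmall, hlarge⟩ j => ?_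
  have h1 := Set.mem_iInter.1 hm j
  simp only [Set.mem_preimage, Set.mem_Ici] at h1
  have h2 := (abs_lt.1 (hsmall j)).1
  linarith

/-- Independent Brownian motions are simultaneously above any line through the origin at
arbitrarily small positive times. -/
lemma ae_exists_lt_forall_mul_le [Fintype ι] (hW : ∀ j, IsPreBrownianReal (W j) P)
    (hind : iIndepFun (fun j ω t => W j t ω) P) (hm : ∀ j t, Measurable (W j t)) (a : ℝ) :
    ∀ᵐ ω ∂P, ∀ ε : ℝ≥0, 0 < ε → ∃ t, 0 < t ∧ t < ε ∧ ∀ j, a * t ≤ W j t ω := by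
  -- Time inversion: t W(1/t) is again Brownian, and t W(1/t) ≥ a at large t says W(s) ≥ a s at s =
  -- 1/t.
  have hind' : iIndepFun (fun j ω (t : ℝ≥0) => (t : ℝ) * W j (1 / t) ω) P :=
    hind.comp (fun _ (x : ℝ≥0 → ℝ) (t : ℝ≥0) => (t : ℝ) * x (1 / t)) fun _ => by fun_prop
  filter_upwards [ae_frequently_forall_le (fun j => (hW j).inv) hind'
    (fun j t => (hm j _).const_mul _) a] with ω hω ε hε
  obtain ⟨t, ht, hlt⟩ := (hω.and_eventually (eventually_gt_atTop ε⁻¹)).exists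
  have ht0 : 0 < t := lt_trans (inv_pos.2 hε) hlt
  refine ⟨1 / t, by positivity, ?_, fun j => ?_⟩
  · rw [one_div]
    exact inv_lt_of_inv_lt₀ hε hlt
  · have h := ht j
    have ht' : (0 : ℝ) < t := ht0
    push_cast
    rw [mul_one_div, div_le_iff₀ ht', mul_comm]
    exact h

end Excursion

/-! ### The posterior ratio process determines the Brownian sums -/

/-- Measurability is assumed only for times in the interval, so that the σ-algebra may be that of
the past; freezing the path outside the interval yields a jointly measurable integrand. -/
lemma measurable_intervalIntegral_of_continuousOn {Ω : Type*} [MeasurableSpace Ω] {f : ℝ → Ω → ℝ}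
    {a b : ℝ} (hab : a ≤ b) (hc : ∀ ω, ContinuousOn (fun s => f s ω) (Set.Icc a b))
    (hm : ∀ s ∈ Set.Icc a b, Measurable (f s)) : Measurable fun ω => ∫ s in a..b, f s ω := by
  have hcont : ∀ ω, Continuous fun s => f (Set.projIcc a b hab s) ω := fun ω =>
    (continuousOn_iff_continuous_domRestrict.1 (hc ω)).comp continuous_projIcc
  have hmeas : Measurable (Function.uncurry fun s ω => f (Set.projIcc a b hab s) ω) :=
    measurable_uncurry_of_continuous_of_measurable hcont fun s => hm _ (Set.projIcc a b hab s).2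
  have heq : (fun ω => ∫ s in a..b, f s ω) =
      fun ω => ∫ s in Set.Ioc a b, f (Set.projIcc a b hab s) ω := by
    ext ω
    rw [intervalIntegral.integral_of_le hab]
    refine setIntegral_congr_fun measurableSet_Ioc fun s hs => ?_
    rw [Set.projIcc_of_mem hab (Set.Ioc_subset_Icc_self hs)]
  rw [heq]
  exact hmeas.stronglyMeasurable.integral_prod_left.measurable

section Path

variable {y : ℝ → ℝ} {lam φ : ℝ}

/-- The bounded-variation factor `φ + λ ∫₀ᵗ ds / y_s` of the posterior ratio. -/
noncomputable def clock (y : ℝ → ℝ) (lam φ t : ℝ) : ℝ := φ + lam * ∫ s in (0 : ℝ)..t, 1 / y s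

lemma hasDerivAt_clock (hy : Continuous y) (hpos : ∀ s, 0 < y s) (t : ℝ) :
    HasDerivAt (clock y lam φ) (lam * (1 / y t)) t := by
  have hc : Continuous fun s => 1 / y s := continuous_const.div hy fun s => (hpos s).ne'
  exact ((hc.integral_hasStrictDerivAt 0 t).hasDerivAt.const_mul lam).const_add φ

lemma clock_pos (hy : Continuous y) (hpos : ∀ s, 0 < y s) (hlam : 0 < lam) (hφ : 0 ≤ φ) {t : ℝ}
    (ht : 0 < t) : 0 < clock y lam φ t := by
  have hc : Continuous fun s => 1 / y s := continuous_const.div hy fun s => (hpos s).ne'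
  refine add_pos_of_nonneg_of_pos hφ (mul_pos hlam ?_)
  exact intervalIntegral.intervalIntegral_pos_of_pos (hc.intervalIntegrable _ _)
    (fun s => one_div_pos.2 (hpos s)) ht

lemma clock_zero : clock y lam φ 0 = φ := by simp [clock]

/-- The logarithmic derivative of the clock is λ divided by the product `y * clock`. A positive `s`
is needed because the clock vanishes at 0 when φ = 0. -/
lemma clock_eq_mul_exp (hy : Continuous y) (hpos : ∀ s, 0 < y s) (hlam : 0 < lam) (hφ : 0 ≤ φ)
    {s t : ℝ} (hs : 0 < s) (hst : s ≤ t) :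
    clock y lam φ t =
      clock y lam φ s * Real.exp (∫ r in s..t, lam / (y r * clock y lam φ r)) := by
  have hA : ∀ r ∈ Set.uIcc s t, 0 < clock y lam φ r := fun r hr => by
    rw [Set.uIcc_of_le hst] at hr
    exact clock_pos hy hpos hlam hφ (hs.trans_le hr.1)
  have hAc : Continuous (clock y lam φ) :=
    continuous_iff_continuousAt.2 fun r => (hasDerivAt_clock hy hpos r).continuousAt
  have h := intervalIntegral.integral_eq_sub_of_hasDerivAt
    (f := fun r => Real.log (clock y lam φ r)) (f' := fun r => lam / (y r * clock y lam φ r))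
    (a := s) (b := t)
    (fun r hr => by
      simpa only [mul_one_div, div_div] using
        (hasDerivAt_clock (lam := lam) (φ := φ) hy hpos r).log (hA r hr).ne')
    (ContinuousOn.intervalIntegrable (continuousOn_const.div (hy.mul hAc).continuousOn
      fun r hr => (mul_pos (hpos r) (hA r hr)).ne'))
  rw [h, Real.exp_sub, Real.exp_log (hA t (by simp)), Real.exp_log (hA s (by simp)),
    mul_div_cancel₀ _ (hA s (by simp)).ne']

/-- Supplies the initial condition as s → 0. For φ > 0 this is continuity; for φ = 0 it is the
derivative λ of the clock at 0, where y = 1. -/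
lemma tendsto_div_clock (hy : Continuous y) (hpos : ∀ s, 0 < y s) (hy0 : y 0 = 1)
    (hlam : 0 < lam) (hφ : 0 ≤ φ) :
    Tendsto (fun s => (φ + lam * s) / clock y lam φ s) (𝓝[>] 0) (𝓝 1) := by
  have hd := hasDerivAt_clock (lam := lam) (φ := φ) hy hpos 0
  rcases hφ.eq_or_lt with rfl | hφ
  · have h := hd.tendsto_slope_zero_right
    simp only [zero_add, clock_zero, sub_zero, hy0, div_one, mul_one, smul_eq_mul] at h ⊢
    have h' := (tendsto_const_nhds (x := lam)).div h hlam.ne'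
    rw [div_self hlam.ne'] at h'
    refine h'.congr' ?_
    filter_upwards [self_mem_nhdsWithin] with s (hs : 0 < s)
    have := (clock_pos hy hpos hlam le_rfl hs).ne'
    simp only [Pi.div_apply]
    field_simp
  · have hc : ContinuousAt (fun s => (φ + lam * s) / clock y lam φ s) 0 :=
      (by fun_prop : ContinuousAt (fun s => φ + lam * s) 0).div hd.continuousAt
        (by rw [clock_zero]; exact hφ.ne')
    have h := hc.tendsto
    rw [clock_zero, mul_zero, add_zero, div_self hφ.ne'] at h
    exact h.mono_left nhdsWithin_le_nhds

/-- The clock can be read off the product `y * clock`. -/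
lemma tendsto_mul_exp_clock (hy : Continuous y) (hpos : ∀ s, 0 < y s) (hy0 : y 0 = 1)
    (hlam : 0 < lam) (hφ : 0 ≤ φ) {t : ℝ} (ht : 0 < t) :
    Tendsto (fun s => (φ + lam * s) * Real.exp (∫ r in s..t, lam / (y r * clock y lam φ r)))
      (𝓝[>] 0) (𝓝 (clock y lam φ t)) := by
  have h := (tendsto_div_clock hy hpos hy0 hlam hφ).const_mul (clock y lam φ t)
  rw [mul_one] at h
  refine h.congr' ?_
  filter_upwards [Ioo_mem_nhdsGT ht] with s hs
  rw [clock_eq_mul_exp hy hpos hlam hφ hs.1 hs.2.le]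
  have := (clock_pos hy hpos hlam hφ hs.1).ne'
  field_simp

end Path

section Filtration

variable {Ω : Type*} {n k : ℕ} {mu lam : ℝ} {B : Fin n → ℝ≥0 → Ω → ℝ}

/-- `e^{λ t} L^i_t` for a real time `t`. -/
noncomputable def growth (mu lam : ℝ) (B : Fin n → ℝ≥0 → Ω → ℝ) (i : Idx n k) (t : ℝ) (ω : Ω) : ℝ :=
  Real.exp (lam * t) * likelihood mu B i t.toNNReal ω

lemma growth_pos (i : Idx n k) (t : ℝ) (ω : Ω) : 0 < growth mu lam B i t ω := by
  unfold growth likelihood; positivity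

lemma growth_zero (h0 : ∀ j ω, B j 0 ω = 0) (i : Idx n k) (ω : Ω) :
    growth mu lam B i 0 ω = 1 := by
  simp [growth, likelihood, h0]

lemma continuous_likelihood (hc : ∀ j ω, Continuous fun t => B j t ω) (i : Idx n k) (ω : Ω) :
    Continuous fun t => likelihood mu B i t ω := by
  unfold likelihood
  refine Real.continuous_exp.comp (Continuous.sub (continuous_const.mul
    (continuous_finsetSum _ fun j _ => hc j ω)) (by fun_prop))

lemma continuous_growth (hc : ∀ j ω, Continuous fun t => B j t ω) (i : Idx n k) (ω : Ω) :
    Continuous fun t => growth mu lam B i t ω :=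
  (by fun_prop : Continuous fun t : ℝ => Real.exp (lam * t)).mul
    ((continuous_likelihood hc i ω).comp continuous_real_toNNReal)

lemma ratioReal_eq_growth_mul_clock (φ : State n k) (i : Idx n k) (t : ℝ≥0) (ω : Ω) :
    ratioReal mu lam B φ i t ω =
      growth mu lam B i t ω * clock (fun s => growth mu lam B i s ω) lam (φ i) t := by
  simp [ratioReal, growth, clock]

lemma coe_ratio_toNNReal (hlam : 0 < lam) (φ : State n k) (i : Idx n k) {t : ℝ} (ht : 0 ≤ t)
    (ω : Ω) : (ratio mu lam B φ t.toNNReal ω i : ℝ) =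
      growth mu lam B i t ω * clock (fun s => growth mu lam B i s ω) lam (φ i) t := by
  rw [coe_ratio mu lam hlam.le, ratioReal_eq_growth_mul_clock, Real.coe_toNNReal t ht]

variable [MeasurableSpace Ω]

lemma measurable_ratio_of_growth (hc : ∀ j ω, Continuous fun t => B j t ω) (φ : State n k)
    {t : ℝ≥0} (h : ∀ i : Idx n k, ∀ s ∈ Set.Icc (0 : ℝ) t, Measurable (growth mu lam B i s)) :
    Measurable (ratio mu lam B φ t) := by
  refine measurable_pi_lambda _ fun i => Measurable.real_toNNReal ?_
  have heq : ratioReal mu lam B φ i t = fun ω =>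
      growth mu lam B i t ω * clock (fun s => growth mu lam B i s ω) lam (φ i) t :=
    funext fun ω => ratioReal_eq_growth_mul_clock φ i t ω
  change Measurable (ratioReal mu lam B φ i t)
  rw [heq]
  refine (h i t (by simp)).mul (measurable_const.add (measurable_const.mul ?_))
  refine measurable_intervalIntegral_of_continuousOn t.2 (fun ω => ?_) fun s hs => ?_
  · exact (continuous_const.div (continuous_growth hc i ω) fun s =>
      (growth_pos i s ω).ne').continuousOn
  · exact measurable_const.div (h i s hs)

/-- The σ-algebra on Ω is arbitrary here, so the lemma applies to the one generated by the ratio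
process up to a given time. -/
lemma measurable_growth_of_ratio (hlam : 0 < lam) (hc : ∀ j ω, Continuous fun t => B j t ω)
    (h0 : ∀ j ω, B j 0 ω = 0) (φ : State n k) (i : Idx n k) {t : ℝ} (ht : 0 ≤ t)
    (h : ∀ s ∈ Set.Icc 0 t, Measurable (ratio mu lam B φ s.toNNReal)) :
    Measurable (growth mu lam B i t) := by
  rcases ht.eq_or_lt with rfl | ht'
  · have : growth mu lam B i 0 = fun _ => 1 := funext fun ω => growth_zero h0 i ω
    rw [this]
    exact measurable_const
  set A : ℝ → Ω → ℝ := fun s ω => clock (fun s => growth mu lam B i s ω) lam (φ i) s with hA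
  have hprod : ∀ s ∈ Set.Icc 0 t, Measurable fun ω => growth mu lam B i s ω * A s ω := by
    intro s hs
    have heq : (fun ω => growth mu lam B i s ω * A s ω) =
        fun ω => (ratio mu lam B φ s.toNNReal ω i : ℝ) :=
      funext fun ω => (coe_ratio_toNNReal hlam φ i hs.1 ω).symm
    rw [heq]
    exact ((measurable_pi_apply i).comp (h s hs)).coe_nnreal_real
  have hApos : ∀ s, 0 < s → ∀ ω, 0 < A s ω := fun s hs ω =>
    clock_pos (continuous_growth hc i ω) (fun r => growth_pos i r ω) hlam (φ i).2 hs
  have hAcont : ∀ ω, Continuous fun s => A s ω := fun ω =>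
    continuous_iff_continuousAt.2 fun r =>
      (hasDerivAt_clock (continuous_growth hc i ω) (fun r => growth_pos i r ω) r).continuousAt
  have hAmeas : Measurable (A t) := by
    have hseq : Tendsto (fun m : ℕ => t / ((m : ℝ) + 1)) atTop (𝓝[>] 0) := by
      refine tendsto_nhdsWithin_iff.2 ⟨?_, Eventually.of_forall fun m => by
        simp only [Set.mem_Ioi]; positivity⟩
      have := (tendsto_one_div_add_atTop_nhds_zero_nat (𝕜 := ℝ)).const_mul t
      simpa [div_eq_mul_inv] using this
    refine measurable_of_tendsto_metrizable (f := fun (m : ℕ) ω =>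
      ((φ i : ℝ) + lam * (t / ((m : ℝ) + 1))) * Real.exp (∫ r in (t / ((m : ℝ) + 1))..t,
        lam / (growth mu lam B i r ω * A r ω))) (fun m => ?_) ?_
    · have hs0 : 0 < t / ((m : ℝ) + 1) := by positivity
      have hst : t / ((m : ℝ) + 1) ≤ t := div_le_self ht (by simp)
      refine measurable_const.mul (Real.measurable_exp.comp ?_)
      refine measurable_intervalIntegral_of_continuousOn hst (fun ω => ?_) fun s hs => ?_
      · exact continuousOn_const.div ((continuous_growth hc i ω).mul (hAcont ω)).continuousOn
          fun s hs => (mul_pos (growth_pos i s ω) (hApos s (hs0.trans_le hs.1) ω)).ne'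
      · exact measurable_const.div (hprod s ⟨hs0.le.trans hs.1, hs.2⟩)
    · refine tendsto_pi_nhds.2 fun ω => ?_
      exact (tendsto_mul_exp_clock (continuous_growth hc i ω) (fun r => growth_pos i r ω)
        (growth_zero h0 i ω) hlam (φ i).2 ht').comp hseq
  have : growth mu lam B i t = fun ω => growth mu lam B i t ω * A t ω / A t ω := by
    ext ω
    rw [mul_div_cancel_right₀ _ (hApos t ht' ω).ne']
  rw [this]
  exact (hprod t ⟨ht, le_rfl⟩).div hAmeas

end Filtration

/-! ### Independence of the filtration from the starting point -/

section StoppingTime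

variable {Ω : Type*} {n k : ℕ} {mu lam : ℝ} {B : Fin n → ℝ≥0 → Ω → ℝ}

lemma iSup_comap_ratio_le (hlam : 0 < lam) (hc : ∀ j ω, Continuous fun t => B j t ω)
    (h0 : ∀ j ω, B j 0 ω = 0) (φ ψ : State n k) (t : ℝ≥0) :
    (⨆ s ≤ t, MeasurableSpace.comap (ratio mu lam B φ s) inferInstance) ≤
      ⨆ s ≤ t, MeasurableSpace.comap (ratio mu lam B ψ s) inferInstance := by
  let m : MeasurableSpace Ω := ⨆ s ≤ t, MeasurableSpace.comap (ratio mu lam B ψ s) inferInstance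
  have hψ : ∀ s ≤ t, Measurable[m] (ratio mu lam B ψ s) := fun s hs =>
    measurable_iff_comap_le.2 (le_iSup₂_of_le s hs le_rfl)
  refine iSup₂_le fun s hs => measurable_iff_comap_le.1 ?_
  refine measurable_ratio_of_growth hc φ fun i r hr => ?_
  refine measurable_growth_of_ratio hlam hc h0 ψ i hr.1 fun q hq => hψ _ ?_
  exact (Real.toNNReal_le_iff_le_coe.2 (hq.2.trans hr.2)).trans hs

/-- The stopping times of the posterior ratio process do not depend on its starting point. -/
lemma IsStoppingTimeOf.of_ratio (hlam : 0 < lam) (hc : ∀ j ω, Continuous fun t => B j t ω)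
    (h0 : ∀ j ω, B j 0 ω = 0) {φ : State n k} (ψ : State n k) {τ : Ω → ℝ≥0∞}
    (hτ : IsStoppingTimeOf (ratio mu lam B φ) τ) : IsStoppingTimeOf (ratio mu lam B ψ) τ :=
  fun t => iSup_comap_ratio_le hlam hc h0 φ ψ t _ (hτ t)

lemma isStoppingTimeOf_zero {E : Type*} [MeasurableSpace E] (Y : ℝ≥0 → Ω → E) :
    IsStoppingTimeOf Y fun _ => 0 := fun t => by simp

lemma IsStoppingTimeOf.min_const {E : Type*} [MeasurableSpace E] {Y : ℝ≥0 → Ω → E}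
    {τ : Ω → ℝ≥0∞} (hτ : IsStoppingTimeOf Y τ) (T : ℝ≥0) :
    IsStoppingTimeOf Y fun ω => min (τ ω) T := by
  intro t
  by_cases hT : T ≤ t
  · simp [hT]
  · simpa [hT] using hτ t

end StoppingTime

/-! ### Pathwise estimates -/

section Pathwise

variable {Ω : Type*} {n k : ℕ} {mu lam : ℝ} {p : Idx n k → ℝ} {B : Fin n → ℝ≥0 → Ω → ℝ}

/-- Bounding the sum over `i` by `k` times its largest term leaves only one-dimensional exponential
moments to control. -/
lemma likelihood_le_sum_exp (hk : 1 ≤ k) (i : Idx n k) (t : ℝ≥0) (ω : Ω) :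
    likelihood mu B i t ω ≤ ∑ j, Real.exp (k * mu * B j t ω) := by
  have hne : i.1.Nonempty := Finset.card_pos.1 (by rw [i.2]; exact hk)
  obtain ⟨j₀, -, hj₀⟩ := Finset.exists_max_image i.1 (fun j => mu * B j t ω) hne
  have hsum : mu * ∑ j ∈ i.1, B j t ω ≤ k * mu * B j₀ t ω := by
    rw [Finset.mul_sum]
    refine (Finset.sum_le_card_nsmul _ _ _ hj₀).trans_eq ?_
    rw [i.2, nsmul_eq_mul, mul_assoc]
  have hdrift : (0 : ℝ) ≤ k * (mu ^ 2 / 2) * t := by positivity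
  calc likelihood mu B i t ω ≤ Real.exp (k * mu * B j₀ t ω) :=
        Real.exp_le_exp.2 (by linarith)
    _ ≤ _ := Finset.single_le_sum (f := fun j => Real.exp (k * mu * B j t ω))
        (fun j _ => (Real.exp_pos _).le) (Finset.mem_univ j₀)

lemma sum_mul_likelihood_le (hk : 1 ≤ k) (hp : ∀ i, 0 ≤ p i) (hp1 : ∑ i, p i = 1) (t : ℝ≥0)
    (ω : Ω) : ∑ i, p i * likelihood mu B i t ω ≤ ∑ j, Real.exp (k * mu * B j t ω) :=
  calc ∑ i, p i * likelihood mu B i t ω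
      ≤ ∑ i, p i * ∑ j, Real.exp (k * mu * B j t ω) :=
        Finset.sum_le_sum fun i _ =>
          mul_le_mul_of_nonneg_left (likelihood_le_sum_exp hk i t ω) (hp i)
    _ = _ := by rw [← Finset.sum_mul, hp1, one_mul]

/-- Each coordinate is affine in its starting value, with slope `growth`. -/
lemma ratio_le_add (hlam : 0 < lam) {φ ψ : State n k} {ε : ℝ≥0}
    (h : ∀ i, ψ i ≤ φ i + ε) (i : Idx n k) {t : ℝ} (ht : 0 ≤ t) (ω : Ω) :
    (ratio mu lam B ψ t.toNNReal ω i : ℝ) ≤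
      ratio mu lam B φ t.toNNReal ω i + ε * growth mu lam B i t ω := by
  rw [coe_ratio_toNNReal hlam _ _ ht, coe_ratio_toNNReal hlam _ _ ht]
  have h' : (ψ i : ℝ) ≤ φ i + ε := by exact_mod_cast h i
  have := mul_le_mul_of_nonneg_left h' (growth_pos (mu := mu) (lam := lam) (B := B) i t ω).le
  unfold clock
  nlinarith

lemma ratio_mono (hlam : 0 < lam) {φ ψ : State n k} (h : φ ≤ ψ) (i : Idx n k) {t : ℝ}
    (ht : 0 ≤ t) (ω : Ω) : (ratio mu lam B φ t.toNNReal ω i : ℝ) ≤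
      ratio mu lam B ψ t.toNNReal ω i := by
  simpa using ratio_le_add (mu := mu) (B := B) (ε := 0) hlam (fun i => by simpa using h i) i
    ht ω

lemma le_ratio_of_forall_le (hlam : 0 < lam) (φ : State n k) {t : ℝ≥0} {ω : Ω}
    (h : ∀ j, mu ^ 2 / 2 * t ≤ mu * B j t ω) : φ ≤ ratio mu lam B φ t ω := by
  intro i
  rw [← NNReal.coe_le_coe, coe_ratio mu lam hlam.le, ratioReal, likelihood, ← Real.exp_add]
  have hsum : (k : ℝ) * (mu ^ 2 / 2) * t ≤ mu * ∑ j ∈ i.1, B j t ω := by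
    rw [Finset.mul_sum]
    refine le_trans (le_of_eq ?_) (Finset.card_nsmul_le_sum _ _ _ fun j _ => h j)
    rw [i.2, nsmul_eq_mul, mul_assoc]
  have hexp : 1 ≤ Real.exp (lam * t + (mu * ∑ j ∈ i.1, B j t ω - k * (mu ^ 2 / 2) * t)) :=
    Real.one_le_exp (add_nonneg (by positivity) (sub_nonneg.2 hsum))
  have hint : 0 ≤ ∫ s in (0 : ℝ)..t,
      1 / (Real.exp (lam * s) * likelihood mu B i s.toNNReal ω) := by
    refine intervalIntegral.integral_nonneg t.2 fun s _ => ?_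
    unfold likelihood
    positivity
  have hA : (φ i : ℝ) ≤ φ i + lam * ∫ s in (0 : ℝ)..t,
      1 / (Real.exp (lam * s) * likelihood mu B i s.toNNReal ω) :=
    le_add_of_nonneg_right (mul_nonneg hlam.le hint)
  exact hA.trans (le_mul_of_one_le_left ((φ i).2.trans hA) hexp)

lemma ofReal_discounted_ratio_le (hlam : 0 < lam) (hp : ∀ i, 0 ≤ p i) {φ ψ : State n k} {ε : ℝ≥0}
    (h : ∀ i, ψ i ≤ φ i + ε) {t : ℝ} (ht : 0 ≤ t) (ω : Ω) :
    ENNReal.ofReal (Real.exp (-lam * t) *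
        ∑ i, p i * (ratio mu lam B ψ t.toNNReal ω i : ℝ)) ≤
      ENNReal.ofReal (Real.exp (-lam * t) *
        ∑ i, p i * (ratio mu lam B φ t.toNNReal ω i : ℝ)) +
      ε * ENNReal.ofReal (∑ i, p i * likelihood mu B i t.toNNReal ω) := by
  have hreal : Real.exp (-lam * t) * ∑ i, p i * (ratio mu lam B ψ t.toNNReal ω i : ℝ) ≤
      Real.exp (-lam * t) * ∑ i, p i * (ratio mu lam B φ t.toNNReal ω i : ℝ) +
        ε * ∑ i, p i * likelihood mu B i t.toNNReal ω := by
    rw [Finset.mul_sum, Finset.mul_sum, Finset.mul_sum, ← Finset.sum_add_distrib]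
    refine Finset.sum_le_sum fun i _ => ?_
    have h1 := ratio_le_add (mu := mu) (B := B) hlam h i ht ω
    -- The discount cancels the factor e^{λt} in the slope.
    have h2 : Real.exp (-lam * t) * growth mu lam B i t ω =
        likelihood mu B i t.toNNReal ω := by
      rw [growth, ← mul_assoc, ← Real.exp_add]
      simp
    rw [← h2]
    have h3 := mul_le_mul_of_nonneg_left h1 (mul_nonneg (Real.exp_pos (-lam * t)).le (hp i))
    linarith
  refine (ENNReal.ofReal_le_ofReal hreal).trans (ENNReal.ofReal_add_le.trans_eq ?_)
  rw [ENNReal.ofReal_mul (NNReal.coe_nonneg ε), ENNReal.ofReal_coe_nnreal]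

end Pathwise

/-! ### Integrability of the likelihood ratios -/

section Likelihood

variable {Ω : Type*} [MeasurableSpace Ω] {n k : ℕ} {mu lam c : ℝ} {p : Idx n k → ℝ}
  {B : Fin n → ℝ≥0 → Ω → ℝ} {P : Measure Ω}

lemma lintegral_exp_mul_brownian {X : ℝ≥0 → Ω → ℝ} (hX : IsPreBrownianReal X P) (θ : ℝ)
    (t : ℝ≥0) : ∫⁻ ω, ENNReal.ofReal (Real.exp (θ * X t ω)) ∂P =
      ENNReal.ofReal (Real.exp (t * θ ^ 2 / 2)) := by
  rw [(hX.hasLaw_eval t).lintegral_comp (f := fun x => ENNReal.ofReal (Real.exp (θ * x)))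
      (by fun_prop),
    ← ofReal_integral_eq_lintegral_ofReal (integrable_exp_mul_gaussianReal θ)
      (Eventually.of_forall fun x => (Real.exp_pos _).le)]
  have h := mgf_gaussianReal (p := gaussianReal 0 t) (X := id) (μ := 0) (v := t)
    Measure.map_id θ
  simp only [mgf, id_eq, zero_mul, zero_add] at h
  rw [h]

lemma measurable_sum_likelihood (hB : IsStandardBrownian B P) :
    Measurable fun q : Ω × ℝ =>
      ENNReal.ofReal (∑ i : Idx n k, p i * likelihood mu B i q.2.toNNReal q.1) := by
  have h : Measurable (Function.uncurry fun (t : ℝ) ω =>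
      ∑ i : Idx n k, p i * likelihood mu B i t.toNNReal ω) := by
    refine measurable_uncurry_of_continuous_of_measurable (fun ω => ?_) fun t => ?_
    · exact continuous_finsetSum _ fun i _ => continuous_const.mul
        ((continuous_likelihood hB.continuous i ω).comp continuous_real_toNNReal)
    · refine Finset.measurable_fun_sum _ fun i _ => measurable_const.mul ?_
      unfold likelihood
      exact Real.measurable_exp.comp ((measurable_const.mul
        (Finset.measurable_fun_sum _ fun j _ => hB.measurable j _)).sub measurable_const)
  exact (h.comp measurable_swap).ennreal_ofReal

/-- `E ∫₀ᵀ ∑ p_i L^i_t dt`. -/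
noncomputable def likelihoodMass (mu : ℝ) (p : Idx n k → ℝ) (B : Fin n → ℝ≥0 → Ω → ℝ)
    (P : Measure Ω) (T : ℝ≥0) : ℝ≥0∞ :=
  ∫⁻ ω, (∫⁻ t in Set.Ioo (0 : ℝ) T,
    ENNReal.ofReal (∑ i, p i * likelihood mu B i t.toNNReal ω)) ∂P

lemma likelihoodMass_ne_top [IsProbabilityMeasure P] (hk : 1 ≤ k) (hp : ∀ i, 0 ≤ p i)
    (hp1 : ∑ i, p i = 1) (hB : IsStandardBrownian B P) (T : ℝ≥0) :
    likelihoodMass mu p B P T ≠ ∞ := by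
  unfold likelihoodMass
  rw [lintegral_lintegral_swap (measurable_sum_likelihood hB).aemeasurable]
  have hbound : ∀ t ∈ Set.Ioo (0 : ℝ) T,
      ∫⁻ ω, ENNReal.ofReal (∑ i, p i * likelihood mu B i t.toNNReal ω) ∂P ≤
        ∑ _j : Fin n, ENNReal.ofReal (Real.exp (T * (k * mu) ^ 2 / 2)) := by
    intro t ht
    calc ∫⁻ ω, ENNReal.ofReal (∑ i, p i * likelihood mu B i t.toNNReal ω) ∂P
        ≤ ∫⁻ ω, ∑ j, ENNReal.ofReal (Real.exp (k * mu * B j t.toNNReal ω)) ∂P := by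
          refine lintegral_mono fun ω => ?_
          rw [← ENNReal.ofReal_sum_of_nonneg fun j _ => (Real.exp_pos _).le]
          exact ENNReal.ofReal_le_ofReal (sum_mul_likelihood_le hk hp hp1 _ ω)
      _ = ∑ j, ENNReal.ofReal (Real.exp (t.toNNReal * (k * mu) ^ 2 / 2)) := by
          rw [lintegral_finsetSum _ fun j _ => by
            have := hB.measurable j t.toNNReal
            fun_prop]
          exact Finset.sum_congr rfl fun j _ =>
            lintegral_exp_mul_brownian (hB.brownian j).toIsPreBrownianReal _ _
      _ ≤ _ := by
          rw [Real.coe_toNNReal t ht.1.le]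
          have := ht.2.le
          gcongr
  refine ne_top_of_le_ne_top ?_ (setLIntegral_mono measurable_const hbound)
  rw [setLIntegral_const]
  refine ENNReal.mul_ne_top ?_ (by simp)
  exact ENNReal.sum_ne_top.2 fun _ _ => ENNReal.ofReal_ne_top

end Likelihood

/-! ### The two parts of the expected cost -/

section Cost

variable {Ω : Type*} [MeasurableSpace Ω] {n k : ℕ} {mu lam c : ℝ} {p : Idx n k → ℝ}
  {B : Fin n → ℝ≥0 → Ω → ℝ} {P : Measure Ω}

/-- The expected discounted cost `E ∫₀^τ e^{-λ t} ∑ p_i Φ^i_t dt`. -/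
noncomputable def delayCost (mu lam : ℝ) (p : Idx n k → ℝ) (B : Fin n → ℝ≥0 → Ω → ℝ)
    (P : Measure Ω) (φ : State n k) (τ : Ω → ℝ≥0∞) : ℝ≥0∞ :=
  ∫⁻ ω, (∫⁻ t in {t : ℝ | 0 < t ∧ ENNReal.ofReal t < τ ω},
    ENNReal.ofReal (Real.exp (-lam * t) *
      ∑ i, p i * (ratio mu lam B φ t.toNNReal ω i : ℝ))) ∂P

/-- The expected discounted gain `E ∫₀^τ e^{-λ t} (λ / c) dt`. -/
noncomputable def alarmGain (lam c : ℝ) (P : Measure Ω) (τ : Ω → ℝ≥0∞) : ℝ≥0∞ :=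
  ∫⁻ ω, (∫⁻ t in {t : ℝ | 0 < t ∧ ENNReal.ofReal t < τ ω},
    ENNReal.ofReal (Real.exp (-lam * t) * (lam / c))) ∂P

lemma expectedCost_eq_sub (φ : State n k) (τ : Ω → ℝ≥0∞) :
    expectedCost mu lam c p B P φ τ =
      (delayCost mu lam p B P φ τ : EReal) - (alarmGain lam c P τ : EReal) := rfl

lemma lintegral_Ioi_discount (hlam : 0 < lam) (hc : 0 < c) (T : ℝ) :
    ∫⁻ t in Set.Ioi T, ENNReal.ofReal (Real.exp (-lam * t) * (lam / c)) =
      ENNReal.ofReal (Real.exp (-lam * T) / c) := by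
  rw [← ofReal_integral_eq_lintegral_ofReal
    ((integrableOn_exp_mul_Ioi (neg_lt_zero.2 hlam) T).mul_const _)
    (Eventually.of_forall fun t => by simp only [Pi.zero_apply]; positivity),
    integral_mul_const, integral_exp_mul_Ioi (neg_lt_zero.2 hlam)]
  congr 1
  field_simp

lemma alarmGain_ne_top [IsProbabilityMeasure P] (hlam : 0 < lam) (hc : 0 < c)
    (τ : Ω → ℝ≥0∞) : alarmGain lam c P τ ≠ ∞ := by
  have hle : alarmGain lam c P τ ≤ ∫⁻ _, ENNReal.ofReal (Real.exp (-lam * 0) / c) ∂P :=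
    lintegral_mono fun ω => by
      rw [← lintegral_Ioi_discount hlam hc]
      exact lintegral_mono_set fun t ht => ht.1
  refine ne_top_of_le_ne_top ?_ hle
  simp

/-- Truncating a stopping time at `T` loses at most the discounted gain after `T`. -/
lemma alarmGain_le_min_add [IsProbabilityMeasure P] (hlam : 0 < lam) (hc : 0 < c)
    (τ : Ω → ℝ≥0∞) (T : ℝ≥0) :
    alarmGain lam c P τ ≤ alarmGain lam c P (fun ω => min (τ ω) T) +
      ENNReal.ofReal (Real.exp (-lam * T) / c) := by
  have hconst : ENNReal.ofReal (Real.exp (-lam * T) / c) =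
      ∫⁻ _, ENNReal.ofReal (Real.exp (-lam * T) / c) ∂P := by simp
  rw [hconst]
  unfold alarmGain
  rw [← lintegral_add_right _ measurable_const]
  refine lintegral_mono fun ω => ?_
  -- The half-line is closed up so that the union below also covers t = T.
  rw [← lintegral_Ioi_discount hlam hc, ← setLIntegral_congr Ioi_ae_eq_Ici.symm]
  refine le_trans (lintegral_mono_set fun t ht => ?_) (lintegral_union_le _ _ _)
  by_cases h : t < T
  · refine Or.inl ⟨ht.1, lt_min ht.2 ?_⟩
    rw [← ENNReal.ofReal_coe_nnreal]
    exact (ENNReal.ofReal_lt_ofReal_iff (ht.1.trans h)).2 h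
  · exact Or.inr (not_lt.1 h)

lemma measurableSet_pos_ofReal_lt (a : ℝ≥0∞) :
    MeasurableSet {t : ℝ | 0 < t ∧ ENNReal.ofReal t < a} :=
  measurableSet_Ioi.inter (measurableSet_lt ENNReal.measurable_ofReal measurable_const)

lemma delayCost_mono (hlam : 0 < lam) (hp : ∀ i, 0 ≤ p i) {φ ψ : State n k} (h : φ ≤ ψ)
    (τ : Ω → ℝ≥0∞) : delayCost mu lam p B P φ τ ≤ delayCost mu lam p B P ψ τ := by
  refine lintegral_mono fun ω => setLIntegral_mono' (measurableSet_pos_ofReal_lt _)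
    fun t ht => ENNReal.ofReal_le_ofReal ?_
  refine mul_le_mul_of_nonneg_left (Finset.sum_le_sum fun i _ => ?_) (Real.exp_pos _).le
  exact mul_le_mul_of_nonneg_left (ratio_mono hlam h i ht.1.le ω) (hp i)

lemma setLIntegral_min_le_add {f g h : ℝ → ℝ≥0∞} (hh : Measurable h) (ε : ℝ≥0∞)
    (hle : ∀ t, 0 < t → f t ≤ g t + ε * h t) (a : ℝ≥0∞) (T : ℝ≥0) :
    ∫⁻ t in {t : ℝ | 0 < t ∧ ENNReal.ofReal t < min a T}, f t ≤
      (∫⁻ t in {t : ℝ | 0 < t ∧ ENNReal.ofReal t < a}, g t) +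
        ε * ∫⁻ t in Set.Ioo (0 : ℝ) T, h t := by
  refine (setLIntegral_mono' (measurableSet_pos_ofReal_lt _) fun t ht => hle t ht.1).trans ?_
  rw [lintegral_add_right _ (hh.const_mul _), lintegral_const_mul _ hh]
  have hsub : {t : ℝ | 0 < t ∧ ENNReal.ofReal t < min a T} ⊆ Set.Ioo (0 : ℝ) T := by
    rintro t ⟨ht0, ht⟩
    have := ht.trans_le (min_le_right _ _)
    rw [← ENNReal.ofReal_coe_nnreal] at this
    exact ⟨ht0, (ENNReal.ofReal_lt_ofReal_iff_of_nonneg ht0.le).1 this⟩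
  exact add_le_add (lintegral_mono_set fun t ht => ⟨ht.1, ht.2.trans_le (min_le_left _ _)⟩)
    (mul_le_mul' le_rfl (lintegral_mono_set hsub))

/-- Up to a bounded time, the delay cost grows at most linearly in the starting point. -/
lemma delayCost_min_le (hlam : 0 < lam) (hp : ∀ i, 0 ≤ p i) (hB : IsStandardBrownian B P)
    {φ ψ : State n k} {ε : ℝ≥0} (h : ∀ i, ψ i ≤ φ i + ε) (τ : Ω → ℝ≥0∞) (T : ℝ≥0) :
    delayCost mu lam p B P ψ (fun ω => min (τ ω) T) ≤
      delayCost mu lam p B P φ τ + ε * likelihoodMass mu p B P T := by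
  have hmeas := measurable_sum_likelihood (mu := mu) (p := p) hB
  have hmass : Measurable fun ω => ∫⁻ t in Set.Ioo (0 : ℝ) T,
      ENNReal.ofReal (∑ i, p i * likelihood mu B i t.toNNReal ω) := hmeas.lintegral_prod_right'
  unfold delayCost likelihoodMass
  rw [← lintegral_const_mul _ hmass, ← lintegral_add_right _ (hmass.const_mul _)]
  refine lintegral_mono fun ω => ?_
  exact setLIntegral_min_le_add (hmeas.comp measurable_prodMk_left) ε
    (fun t ht => ofReal_discounted_ratio_le hlam hp h ht.le ω) (τ ω) T

/-- The delay cost may be infinite; finiteness of the gain is what makes the extended subtraction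
harmless. -/
lemma expectedCost_neg_iff [IsProbabilityMeasure P] (hlam : 0 < lam) (hc : 0 < c)
    (φ : State n k) (τ : Ω → ℝ≥0∞) : expectedCost mu lam c p B P φ τ < 0 ↔
      delayCost mu lam p B P φ τ < alarmGain lam c P τ := by
  rw [expectedCost_eq_sub, EReal.sub_neg, EReal.coe_ennreal_lt_coe_ennreal_iff]
  · exact Or.inr (by simpa using alarmGain_ne_top hlam hc τ)
  · exact Or.inl (EReal.coe_ennreal_ne_bot _)

end Cost

/-! ### The value function -/

section Value

variable {Ω : Type*} [MeasurableSpace Ω] {n k : ℕ} {mu lam c : ℝ} {p : Idx n k → ℝ}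
  {B : Fin n → ℝ≥0 → Ω → ℝ} {P : Measure Ω}

lemma value_nonpos (φ : State n k) : value mu lam c p B P φ ≤ 0 := by
  refine iInf₂_le_of_le (fun _ => 0) (isStoppingTimeOf_zero _) ?_
  simp [expectedCost]

lemma value_mono (hlam : 0 < lam) (hp : ∀ i, 0 ≤ p i) (hB : IsStandardBrownian B P)
    {φ ψ : State n k} (h : φ ≤ ψ) : value mu lam c p B P φ ≤ value mu lam c p B P ψ := by
  refine le_iInf₂ fun τ hτ => iInf₂_le_of_le τ (hτ.of_ratio hlam hB.continuous hB.zero φ) ?_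
  rw [expectedCost_eq_sub, expectedCost_eq_sub]
  exact EReal.sub_le_sub (EReal.coe_ennreal_le_coe_ennreal_iff.2 (delayCost_mono hlam hp h τ))
    le_rfl

/-- The stopping set is an upper set. -/
lemma mem_stoppingSet_of_le (hlam : 0 < lam) (hp : ∀ i, 0 ≤ p i) (hB : IsStandardBrownian B P)
    {φ ψ : State n k} (h : φ ≤ ψ) (hφ : φ ∈ stoppingSet mu lam c p B P) :
    ψ ∈ stoppingSet mu lam c p B P :=
  le_antisymm (value_nonpos ψ) (hφ.symm.trans_le (value_mono hlam hp hB h))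

lemma isOpen_continuationSet [IsProbabilityMeasure P] (hk : 1 ≤ k) (hlam : 0 < lam) (hc : 0 < c)
    (hp : ∀ i, 0 ≤ p i) (hp1 : ∑ i, p i = 1) (hB : IsStandardBrownian B P) :
    IsOpen (continuationSet mu lam c p B P) := by
  refine isOpen_iff_mem_nhds.2 fun φ hφ => ?_
  obtain ⟨τ, hτ, hneg⟩ : ∃ τ, ∃ _ : IsStoppingTimeOf (ratio mu lam B φ) τ,
      expectedCost mu lam c p B P φ τ < 0 := by
    simpa only [value, iInf_lt_iff] using (show value mu lam c p B P φ < 0 from hφ)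
  rw [expectedCost_neg_iff hlam hc] at hneg
  obtain ⟨T, hT⟩ : ∃ T : ℝ≥0, delayCost mu lam p B P φ τ +
      ENNReal.ofReal (Real.exp (-lam * T) / c) < alarmGain lam c P τ := by
    have h0 : Tendsto (fun T : ℝ≥0 => Real.exp (-lam * T) / c) atTop (𝓝 0) := by
      have h1 : Tendsto (fun T : ℝ≥0 => -lam * (T : ℝ)) atTop atBot :=
        (NNReal.tendsto_coe_atTop.2 tendsto_id).const_mul_atTop_of_neg (neg_lt_zero.2 hlam)
      simpa using (Real.tendsto_exp_atBot.comp h1).div_const c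
    have h1 := (ENNReal.tendsto_ofReal h0).const_add (delayCost mu lam p B P φ τ)
    rw [ENNReal.ofReal_zero, add_zero] at h1
    exact (h1.eventually_lt_const hneg).exists
  -- The tail of the gain after T is cancelled from both sides; the delay cost is still that of the
  -- untruncated `τ`.
  have hT' : delayCost mu lam p B P φ τ < alarmGain lam c P fun ω => min (τ ω) T :=
    lt_of_add_lt_add_right (hT.trans_le (alarmGain_le_min_add hlam hc τ T))
  obtain ⟨ε, hε, hlt⟩ : ∃ ε : ℝ≥0, 0 < ε ∧ delayCost mu lam p B P φ τ +
      ε * likelihoodMass mu p B P T < alarmGain lam c P fun ω => min (τ ω) T := by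
    have h0 : Tendsto (fun ε : ℝ≥0 => (ε : ℝ≥0∞) * likelihoodMass mu p B P T) (𝓝[>] 0) (𝓝 0) := by
      have h1 : Tendsto (fun ε : ℝ≥0 => (ε : ℝ≥0∞)) (𝓝[>] 0) (𝓝 ((0 : ℝ≥0) : ℝ≥0∞)) :=
        (ENNReal.tendsto_coe.2 tendsto_id).mono_left nhdsWithin_le_nhds
      have h2 := ENNReal.Tendsto.mul_const h1
        (Or.inr (likelihoodMass_ne_top (mu := mu) hk hp hp1 hB T))
      simpa using h2
    have h1 := h0.const_add (delayCost mu lam p B P φ τ)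
    rw [add_zero] at h1
    obtain ⟨ε, h, hε⟩ := ((h1.eventually_lt_const hT').and self_mem_nhdsWithin).exists
    exact ⟨ε, hε, h⟩
  have hnhds : ∀ᶠ ψ : State n k in 𝓝 φ, ∀ i, ψ i < φ i + ε :=
    eventually_all.2 fun i => ((continuous_apply i).tendsto φ).eventually_lt_const
      (lt_add_of_pos_right _ hε)
  filter_upwards [hnhds] with ψ hψ
  change value mu lam c p B P ψ < 0
  refine (iInf₂_le _ ((hτ.min_const T).of_ratio hlam hB.continuous hB.zero ψ)).trans_lt ?_
  rw [expectedCost_neg_iff hlam hc]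
  exact (delayCost_min_le hlam hp hB (fun i => (hψ i).le) τ T).trans_lt hlt

end Value

/-! ### Return above the starting point -/

section Regular

variable {Ω : Type*} [MeasurableSpace Ω] {n k : ℕ} {mu lam c : ℝ} {p : Idx n k → ℝ}
  {B : Fin n → ℝ≥0 → Ω → ℝ} {P : Measure Ω}

lemma ae_exists_lt_forall_sq_le (hmu : mu ≠ 0) (hB : IsStandardBrownian B P) :
    ∀ᵐ ω ∂P, ∀ ε : ℝ≥0, 0 < ε →
      ∃ t, 0 < t ∧ t < ε ∧ ∀ j, mu ^ 2 / 2 * t ≤ mu * B j t ω := by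
  rcases hmu.lt_or_gt with hneg | hpos
  -- For μ < 0 the excursion lemma is applied to -B with slope -μ/2; multiplying by -μ > 0 restores
  -- the sign.
  · have hind : iIndepFun (fun j ω t => (-B j) t ω) P :=
      hB.indep.comp (fun _ (x : ℝ≥0 → ℝ) => -x) fun _ => measurable_neg
    filter_upwards [ae_exists_lt_forall_mul_le
      (fun j => (hB.brownian j).toIsPreBrownianReal.neg) hind
      (fun j t => (hB.measurable j t).neg) (-mu / 2)] with ω hω ε hε
    obtain ⟨t, ht, htε, h⟩ := hω ε hε
    refine ⟨t, ht, htε, fun j => ?_⟩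
    have := mul_le_mul_of_nonneg_left (h j) (neg_pos.2 hneg).le
    simp only [Pi.neg_apply] at this
    linarith
  · filter_upwards [ae_exists_lt_forall_mul_le
      (fun j => (hB.brownian j).toIsPreBrownianReal) hB.indep hB.measurable (mu / 2)]
      with ω hω ε hε
    obtain ⟨t, ht, htε, h⟩ := hω ε hε
    refine ⟨t, ht, htε, fun j => ?_⟩
    have := mul_le_mul_of_nonneg_left (h j) hpos.le
    linarith

/-- Every point of the stopping set is regular for it. -/
lemma isRegularFor_stoppingSet (hmu : mu ≠ 0) (hlam : 0 < lam) (hp : ∀ i, 0 ≤ p i)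
    (hB : IsStandardBrownian B P) {φ : State n k} (hφ : φ ∈ stoppingSet mu lam c p B P) :
    IsRegularFor mu lam B P (stoppingSet mu lam c p B P) φ := by
  filter_upwards [ae_exists_lt_forall_sq_le hmu hB] with ω hω
  refine le_antisymm (ENNReal.le_of_forall_pos_le_add fun ε hε _ => ?_) zero_le
  obtain ⟨t, ht, htε, h⟩ := hω ε hε
  rw [zero_add]
  refine iInf₂_le_of_le t ⟨ht, ?_⟩ (by exact_mod_cast htε.le)
  exact mem_stoppingSet_of_le hlam hp hB (le_ratio_of_forall_le hlam φ h) hφ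

end Regular

end QuickestDetection

theorem proposition7 {Ω : Type*} [MeasurableSpace Ω] (P : Measure Ω) [IsProbabilityMeasure P]
    {n k : ℕ} (hk : 1 ≤ k) (hkn : k < n)
    (mu lam c : ℝ) (hmu : mu ≠ 0) (hlam : 0 < lam) (hc : 0 < c)
    (p : QuickestDetection.Idx n k → ℝ) (hp : ∀ i, 0 ≤ p i) (hp1 : ∑ i, p i = 1)
    (B : Fin n → ℝ≥0 → Ω → ℝ) (hB : QuickestDetection.IsStandardBrownian B P) :
    ∀ φ ∈ frontier (QuickestDetection.continuationSet mu lam c p B P),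
      QuickestDetection.IsRegularFor mu lam B P
        (QuickestDetection.stoppingSet mu lam c p B P) φ := by
  intro φ hφ
  -- The frontier of an open set is disjoint from it, so the value at φ is not negative.
  rw [(QuickestDetection.isOpen_continuationSet hk hlam hc hp hp1 hB).frontier_eq] at hφ
  exact QuickestDetection.isRegularFor_stoppingSet hmu hlam hp hB
    (le_antisymm (QuickestDetection.value_nonpos φ) (not_lt.1 hφ.2))
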